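/- **Corollary 2.3.** For a complex Borel measure $\mu$ on $\mathbb{R}$ (countably additive and $\mathbb{C}$-valued, hence finite) put $\hat\mu(\xi)=\int_{\mathbb{R}}e^{i\xi x}\,d\mu(x)$, $\xi\in\mathbb{R}$. A function $F:\mathbb{R}\to\mathbb{C}$ is called a *symbol* if for every compact $K\subset\mathbb{R}$ there is a complex Borel measure $\mu$ with $F=\hat\mu$ in a neighbourhood of $K$. Let $\mathcal{A}$ be a complex unital Banach algebra, with unit $\mathbf 1$, $\|\mathbf 1\|=1$, and $\|ab\|\le\|a\|\,\|b\|$. An element $a\in\mathcal{A}$ is *Hermitian* if its numerical range $V(a)=\{\varphi(a):\varphi\in\mathcal{A}^*,\ \varphi(\mathbf 1)=\|\varphi\|=1\}$ is contained in $\mathbb{R}$; then its spectrum $\sigma(a)$ is contained in $\mathbb{R}$. For a symbol $F$ and a Hermitian $a$ put $F(a)=\int_{\mathbb{R}}\exp(ita)\,d\mu(t)\in\mathcal{A}$, where $\mu$ is any complex Borel measure with $F=\hat\mu$ in a neighbourhood of $\sigma(a)$ in $\mathbb{R}$ (the result does not depend on $\mu$). A symbol $F$ is *universal* if $\|F(a)\|=|F(a)|$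 for every complex unital Banach algebra $\mathcal{A}$ and every Hermitian $a\in\mathcal{A}$, where $|b|=\max\{|\lambda|:\lambda\in\sigma(b)\}$ denotes the spectral radius of $b\in\mathcal{A}$. Let $F$ be a universal symbol. Then $F$ is bounded on $\mathbb{R}$ if and only if there exist $\alpha\in\mathbb{R}$ and $c\in\mathbb{C}$ such that $F(x)=c\,e^{i\alpha x}$ for all $x\in\mathbb{R}$. -/

import Mathlib

open scoped Topology

universe u

noncomputable section

namespace UniversalSymbols

open MeasureTheory

/-- Fourier-Stieltjes transform `μ̂(ξ) = ∫ exp(iξx) dμ(x)` of a complex Borel measure `μ` on `ℝ`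
(a countably additive `ℂ`-valued set function, hence automatically finite). -/
def fourierStieltjes (μ : ComplexMeasure ℝ) (ξ : ℝ) : ℂ :=
  VectorMeasure.integral μ (fun x : ℝ => Complex.exp (Complex.I * ξ * x))
    (ContinuousLinearMap.mul ℝ ℂ)

/-- The algebra `B(ℝ)_loc` of symbols: functions that belong locally to the Fourier-Stieltjes
algebra `B(ℝ)`, i.e. agree near each compact set with the transform of some complex measure. -/
def IsSymbol (F : ℝ → ℂ) : Prop :=
  ∀ K : Set ℝ, IsCompact K →
    ∃ μ : ComplexMeasure ℝ, ∀ᶠ x in 𝓝ˢ K, F x = fourierStieltjes μ x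

section BanachAlgebra

variable {A : Type u} [NormedRing A] [NormedAlgebra ℂ A]

/-- The numerical range `V(a) = {φ(a) : φ ∈ A*, φ(1) = ‖φ‖ = 1}`. -/
def numericalRange (a : A) : Set ℂ :=
  {z | ∃ φ : StrongDual ℂ A, φ 1 = 1 ∧ ‖φ‖ = 1 ∧ φ a = z}

/-- An element is Hermitian if its numerical range is real. -/
def IsHermitian (a : A) : Prop :=
  ∀ z ∈ numericalRange a, z.im = 0

/-- The Bochner integral `μ̂(a) = ∫ exp(ita) dμ(t)` in `A`. For Hermitian `a` one has
`‖exp(ita)‖ = 1`, so the integrand is bounded and continuous, hence integrable. -/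
def expIntegral (μ : ComplexMeasure ℝ) (a : A) : A :=
  VectorMeasure.integral μ (fun t : ℝ => NormedSpace.exp ((Complex.I * t) • a))
    (ContinuousLinearMap.lsmul ℝ ℂ).flip

/-- `b` is the value `F(a)` of the functional calculus: `b = ∫ exp(ita) dμ(t)` for a complex
measure `μ` with `F = μ̂` in a real neighbourhood of the spectrum of `a`. -/
def IsCalculusValue (F : ℝ → ℂ) (a b : A) : Prop :=
  ∃ μ : ComplexMeasure ℝ,
    (∀ᶠ x in 𝓝ˢ (Complex.ofReal ⁻¹' spectrum ℂ a), F x = fourierStieltjes μ x) ∧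
      b = expIntegral μ a

end BanachAlgebra

/-- Universal symbols: symbols `F` such that the norm of `F(a)` is its spectral radius, for every
complex unital Banach algebra `A` (with `‖1‖ = 1`) and every Hermitian `a ∈ A`. -/
def IsUniversalSymbol (F : ℝ → ℂ) : Prop :=
  IsSymbol F ∧
    ∀ (A : Type u) [NormedRing A] [NormedAlgebra ℂ A] [CompleteSpace A] [NormOneClass A]
      (a b : A), IsHermitian a → IsCalculusValue F a b → ‖b‖ₑ = spectralRadius ℂ b

end UniversalSymbols

end

noncomputable section

namespace UniversalSymbols

open MeasureTheory

/-! ### Integration against complex measures; continuity of symbols -/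

section VectorMeasureIntegral

/-! One family of algebras suffices: operators on polynomials of degree at most two, normed by the
supremum on the unit circle. The diagonal operator with entries `x`, `x + h`, `x + 2h` is Hermitian,
since its exponentials are rotations times unimodular scalars. Universality then bounds the norm of
the diagonal operator with entries `F (x + k * h)` by `max |F|`; evaluation at `z = 1` turns this
into a bound on the functional with these coefficients (`IsTernaryExtremal`).

A functional attaining its norm at a monomial is positive after a shift (`re_coeff_sum_nonneg`).
Testing it on `3 - 4v + v²`, and on imaginary-valued polynomials, constrains `|F|` on progressions
(`IsThreePointConvex`); a bounded continuous function so constrained is constant. Once `|F|` is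
constant, the equality case gives `F x * F (x + 2h) = F (x + h)²`, so `F / F 0` is a continuous
unitary character when `F 0 ≠ 0`. The converse is `|exp(iαx)| = 1`. -/

theorem isFiniteMeasure_variation_complexMeasure {X : Type*} [MeasurableSpace X]
    (μ : ComplexMeasure X) : IsFiniteMeasure μ.variation := by
  have hle : μ.variation ≤ (ComplexMeasure.re μ).totalVariation +
      (ComplexMeasure.im μ).totalVariation := by
    refine VectorMeasure.variation_le_of_forall_enorm_le fun E _ => ?_
    have h1 : ‖μ E‖ₑ ≤ ‖ComplexMeasure.re μ E‖ₑ + ‖ComplexMeasure.im μ E‖ₑ := by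
      simp only [← ofReal_norm]
      rw [← ENNReal.ofReal_add (norm_nonneg _) (norm_nonneg _)]
      exact ENNReal.ofReal_le_ofReal (Complex.norm_le_abs_re_add_abs_im (μ E))
    exact h1.trans (add_le_add (SignedMeasure.enorm_le_totalVariation _ _)
      (SignedMeasure.enorm_le_totalVariation _ _))
  exact isFiniteMeasure_of_le _ hle

variable {X E E' F G G' : Type*} [MeasurableSpace X]
  [NormedAddCommGroup E] [NormedSpace ℝ E] [NormedAddCommGroup E'] [NormedSpace ℝ E']
  [NormedAddCommGroup F] [NormedSpace ℝ F] [NormedAddCommGroup G] [NormedSpace ℝ G]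
  [NormedAddCommGroup G'] [NormedSpace ℝ G']

/-- Continuous linear maps that intertwine two pairings commute with the associated integrals. -/
theorem map_vectorMeasure_integral [CompleteSpace G] [CompleteSpace G']
    {μ : VectorMeasure X F} {B : E →L[ℝ] F →L[ℝ] G} {B' : E' →L[ℝ] F →L[ℝ] G'}
    (T : E →L[ℝ] E') (S : G →L[ℝ] G') (h : ∀ x y, S (B x y) = B' (T x) y)
    {f : X → E} (hf : μ.Integrable f) :
    S (VectorMeasure.integral μ f B) = VectorMeasure.integral μ (fun x => T (f x)) B' := by
  refine Integrable.induction (P := fun f => S (VectorMeasure.integral μ f B) =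
    VectorMeasure.integral μ (fun x => T (f x)) B') ?_ ?_ ?_ ?_ hf
  · intro c s hs hμs
    have h1 : (fun x => T (s.indicator (fun _ => c) x)) = s.indicator fun _ => T c := by
      ext x
      by_cases hx : x ∈ s <;> simp [hx]
    rw [h1, VectorMeasure.integral_eq_setToFun, VectorMeasure.integral_eq_setToFun,
      setToFun_indicator_const _ hs hμs.ne, setToFun_indicator_const _ hs hμs.ne]
    exact h c (μ s)
  · intro f g _ hf hg hf' hg'
    have h1 : (fun x => T ((f + g) x)) = (fun x => T (f x)) + fun x => T (g x) := by
      ext x; simp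
    rw [h1, VectorMeasure.integral_add hf hg,
      VectorMeasure.integral_add (T.integrable_comp hf) (T.integrable_comp hg), map_add, hf', hg']
  · have hc (f : X →₁[μ.variation] E) : VectorMeasure.integral μ (fun x => T (f x)) B' =
        VectorMeasure.integral μ (T.compLp f) B' :=
      VectorMeasure.integral_congr_ae (T.coeFn_compLp' f).symm
    simp only [hc]
    exact isClosed_eq (S.continuous.comp VectorMeasure.continuous_integral)
      (VectorMeasure.continuous_integral.comp (T.compLpL 1 μ.variation).continuous)
  · intro f g hfg _ h'
    rw [← VectorMeasure.integral_congr_ae hfg, h']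
    refine VectorMeasure.integral_congr_ae ?_
    filter_upwards [hfg] with x hx
    rw [hx]

end VectorMeasureIntegral

theorem norm_exp_I_mul (ξ x : ℝ) : ‖Complex.exp (Complex.I * ξ * x)‖ = 1 := by
  have h : Complex.I * ξ * x = ((ξ * x : ℝ) : ℂ) * Complex.I := by push_cast; ring
  rw [h, Complex.norm_exp_ofReal_mul_I]

theorem continuous_fourierStieltjes (μ : ComplexMeasure ℝ) : Continuous (fourierStieltjes μ) := by
  have := isFiniteMeasure_variation_complexMeasure μ
  refine VectorMeasure.continuous_of_dominated (bound := fun _ => 1)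
    (fun ξ => (by fun_prop : Continuous fun x : ℝ =>
      Complex.exp (Complex.I * ξ * x)).aestronglyMeasurable)
    (fun ξ => .of_forall fun x => (norm_exp_I_mul ξ x).le) (integrable_const _)
    (.of_forall fun x => by fun_prop)

theorem IsSymbol.continuous {F : ℝ → ℂ} (hF : IsSymbol F) : Continuous F := by
  rw [continuous_iff_continuousAt]
  intro x
  obtain ⟨μ, hμ⟩ := hF {x} isCompact_singleton
  rw [nhdsSet_singleton] at hμ
  exact (continuous_fourierStieltjes μ).continuousAt.congr (hμ.mono fun _ h => h.symm)

/-- For a state `φ`, the function `Re φ(exp(ita))` is at most `1`, with equality at `t = 0`; its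
derivative there, `-Im φ(a)`, must vanish. -/
theorem isHermitian_of_norm_exp_le_one {A : Type u} [NormedRing A] [NormedAlgebra ℂ A]
    [CompleteSpace A] {a : A} (ha : ∀ t : ℝ, ‖NormedSpace.exp ((Complex.I * t) • a)‖ ≤ 1) :
    IsHermitian a := by
  rintro z ⟨φ, h1, hφ, rfl⟩
  have hd : HasDerivAt (fun t : ℝ => (φ (NormedSpace.exp ((Complex.I * t) • a))).re)
      (-(φ a).im) 0 := by
    have h := hasDerivAt_exp_smul_const (𝕂 := ℂ) (Complex.I • a) ((0 : ℝ) : ℂ)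
    have h' := (φ.hasFDerivAt.comp_hasDerivAt _ h).real_of_complex
    convert h' using 1
    · ext t
      rw [mul_comm, mul_smul]
      rfl
    · rw [Complex.ofReal_zero, zero_smul, NormedSpace.exp_zero, one_mul, map_smul, smul_eq_mul,
        Complex.I_mul_re]
  have hmax : IsLocalMax (fun t : ℝ => (φ (NormedSpace.exp ((Complex.I * t) • a))).re) 0 := by
    refine .of_forall fun t => ?_
    calc (φ (NormedSpace.exp ((Complex.I * t) • a))).re
        ≤ ‖φ (NormedSpace.exp ((Complex.I * t) • a))‖ := Complex.re_le_norm _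
      _ ≤ 1 * 1 := φ.le_of_opNorm_le_of_le hφ.le (ha t)
      _ = _ := by simp [h1]
  simpa using hmax.hasDerivAt_eq_zero hd

/-! ### Diagonal operators on quadratic polynomials -/

/-- Polynomials `p 0 + p 1 * z + p 2 * z ^ 2` of degree at most two, to be normed by their supremum
on the unit circle. -/
def QuadPoly : Type u := ULift.{u} (Fin 3 → ℂ)

namespace QuadPoly

instance : AddCommGroup QuadPoly.{u} := inferInstanceAs (AddCommGroup (ULift.{u} (Fin 3 → ℂ)))

instance : Module ℂ QuadPoly.{u} := inferInstanceAs (Module ℂ (ULift.{u} (Fin 3 → ℂ)))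

instance : FiniteDimensional ℂ QuadPoly.{u} :=
  Module.Finite.equiv (ULift.moduleEquiv (R := ℂ) (M := Fin 3 → ℂ)).symm

instance : Nontrivial QuadPoly.{u} := inferInstanceAs (Nontrivial (ULift.{u} (Fin 3 → ℂ)))

/-- The polynomial with given coefficients. -/
def ofCoeff : (Fin 3 → ℂ) ≃ₗ[ℂ] QuadPoly.{u} := ULift.moduleEquiv.symm

/-- The polynomial as a continuous function on the unit circle. -/
def eval : QuadPoly.{u} →ₗ[ℂ] C(Circle, ℂ) where
  toFun p := ⟨fun z => ∑ k, ofCoeff.symm p k * (z : ℂ) ^ (k : ℕ), by fun_prop⟩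
  map_add' p q := by ext z; simp [add_mul, Finset.sum_add_distrib]
  map_smul' c p := by ext z; simp [mul_assoc, Finset.mul_sum]

theorem eval_ofCoeff (p : Fin 3 → ℂ) (z : Circle) :
    eval (ofCoeff.{u} p) z = p 0 + p 1 * z + p 2 * z ^ 2 := by
  simp [eval, Fin.sum_univ_three]

theorem eval_injective : Function.Injective eval.{u} := by
  rw [injective_iff_map_eq_zero]
  intro p hp
  obtain ⟨c, rfl⟩ := ofCoeff.{u}.surjective p
  have h (z : ℂ) (hz : ‖z‖ = 1) : c 0 + c 1 * z + c 2 * z ^ 2 = 0 := by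
    obtain ⟨w, rfl⟩ : ∃ w : Circle, (w : ℂ) = z :=
      ⟨⟨z, by simpa [Submonoid.unitSphere] using hz⟩, rfl⟩
    rw [← eval_ofCoeff.{u}, hp, ContinuousMap.zero_apply]
  have h1 := h 1 (by simp)
  have h2 := h (-1) (by simp)
  have h3 := h Complex.I (by simp)
  have hI : (Complex.I : ℂ) ^ 2 = -1 := Complex.I_sq
  have e1 : c 1 = 0 := by linear_combination (h1 - h2) / 2
  have e2 : c 2 = 0 := by
    linear_combination (h1 - h3) / 2 + c 2 / 2 * hI + (Complex.I - 1) / 2 * e1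
  have e0 : c 0 = 0 := by linear_combination h1 - e1 - e2
  have : c = 0 := by
    ext k
    fin_cases k <;> simp [e0, e1, e2]
  rw [this, map_zero]

instance : NormedAddCommGroup QuadPoly.{u} :=
  NormedAddCommGroup.induced _ C(Circle, ℂ) eval eval_injective

instance : NormedSpace ℂ QuadPoly.{u} := NormedSpace.induced ℂ _ C(Circle, ℂ) eval

theorem norm_def (p : QuadPoly.{u}) : ‖p‖ = ‖eval p‖ := rfl

instance : CompleteSpace QuadPoly.{u} := FiniteDimensional.complete ℂ _

theorem norm_eval_le (p : QuadPoly.{u}) (z : Circle) : ‖eval p z‖ ≤ ‖p‖ :=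
  (eval p).norm_coe_le_norm z

theorem norm_le {p : QuadPoly.{u}} {C : ℝ} (hC : 0 ≤ C) (h : ∀ z, ‖eval p z‖ ≤ C) : ‖p‖ ≤ C :=
  (ContinuousMap.norm_le _ hC).2 h

/-- The operator multiplying the coefficients by given numbers. -/
def diagonal : (Fin 3 → ℂ) →ₐ[ℂ] (QuadPoly.{u} →L[ℂ] QuadPoly.{u}) where
  toFun d := LinearMap.toContinuousLinearMap
    (ofCoeff.toLinearMap ∘ₗ LinearMap.mulLeft ℂ d ∘ₗ ofCoeff.symm.toLinearMap)
  map_one' := by ext p : 1; simp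
  map_mul' d e := by ext p : 1; simp
  map_zero' := by ext p : 1; simp
  map_add' d e := by ext p : 1; simp [add_mul]
  commutes' c := by
    ext p : 1
    simp [Algebra.algebraMap_eq_smul_one]

theorem diagonal_apply (d p : Fin 3 → ℂ) : diagonal.{u} d (ofCoeff p) = ofCoeff (d * p) := by
  simp [diagonal]

theorem continuous_diagonal : Continuous diagonal.{u} :=
  diagonal.{u}.toLinearMap.continuous_of_finiteDimensional

theorem exp_smul_diagonal (c : ℂ) (d : Fin 3 → ℂ) :
    NormedSpace.exp (c • diagonal.{u} d) = diagonal fun k => Complex.exp (c * d k) := by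
  have h := NormedSpace.map_exp_of_mem_ball (𝕂 := ℂ) diagonal.{u} continuous_diagonal (c • d)
    ((NormedSpace.expSeries_radius_eq_top ℂ (Fin 3 → ℂ)).symm ▸ edist_lt_top _ _)
  rw [← map_smul, ← h, Pi.exp_def]
  simp [Complex.exp_eq_exp_ℂ]

theorem isHermitian_diagonal (x h : ℝ) :
    IsHermitian (diagonal.{u} fun k => ((x + (k : ℕ) * h : ℝ) : ℂ)) := by
  refine isHermitian_of_norm_exp_le_one fun t => ?_
  rw [exp_smul_diagonal]
  refine ContinuousLinearMap.opNorm_le_bound _ zero_le_one fun p => ?_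
  obtain ⟨p, rfl⟩ := ofCoeff.{u}.surjective p
  rw [one_mul, diagonal_apply]
  refine norm_le (norm_nonneg _) fun z => ?_
  -- `exp(ita)` is the rotation `z ↦ exp(ith) z` followed by a unimodular factor.
  have key : eval (ofCoeff.{u} ((fun k : Fin 3 =>
      Complex.exp (Complex.I * t * ((x + (k : ℕ) * h : ℝ) : ℂ))) * p)) z =
      Complex.exp (Complex.I * t * x) * eval (ofCoeff.{u} p) (Circle.exp (t * h) * z) := by
    have e (k : ℕ) : Complex.exp (Complex.I * t * ((x + k * h : ℝ) : ℂ)) =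
        Complex.exp (Complex.I * t * x) * Complex.exp (t * h * Complex.I) ^ k := by
      rw [← Complex.exp_nat_mul, ← Complex.exp_add]
      push_cast
      ring_nf
    simp only [eval_ofCoeff, Pi.mul_apply, e, Circle.coe_mul, Circle.coe_exp]
    push_cast
    simp
    ring
  rw [key, norm_mul, norm_exp_I_mul, one_mul]
  exact norm_eval_le _ _

theorem norm_coeff_sum_le (d p : Fin 3 → ℂ) {C : ℝ} (hC : 0 ≤ C)
    (hp : ∀ z : Circle, ‖p 0 + p 1 * z + p 2 * (z : ℂ) ^ 2‖ ≤ C) :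
    ‖d 0 * p 0 + d 1 * p 1 + d 2 * p 2‖ ≤ ‖diagonal.{u} d‖ * C := by
  have h1 : ‖ofCoeff.{u} p‖ ≤ C := norm_le hC fun z => by rw [eval_ofCoeff]; exact hp z
  have h2 := norm_eval_le (diagonal.{u} d (ofCoeff p)) 1
  rw [diagonal_apply, eval_ofCoeff] at h2
  rw [← diagonal_apply] at h2
  simp only [Pi.mul_apply, Circle.coe_one, mul_one, one_pow] at h2
  exact h2.trans ((diagonal.{u} d).le_opNorm_of_le h1)

theorem expIntegral_diagonal (μ : ComplexMeasure ℝ) (x : Fin 3 → ℝ) :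
    expIntegral μ (diagonal.{u} fun k => (x k : ℂ)) =
      diagonal fun k => fourierStieltjes μ (x k) := by
  have := isFiniteMeasure_variation_complexMeasure μ
  let f : ℝ → Fin 3 → ℂ := fun t k => Complex.exp (Complex.I * t * x k)
  have hfc : Continuous f := by fun_prop
  have hf : VectorMeasure.Integrable μ f :=
    Integrable.of_bound hfc.aestronglyMeasurable 1
      (.of_forall fun t => (pi_norm_le_iff_of_nonneg zero_le_one).2
        fun k => (norm_exp_I_mul t (x k)).le)
  let D : (Fin 3 → ℂ) →L[ℝ] (QuadPoly.{u} →L[ℂ] QuadPoly.{u}) :=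
    (⟨diagonal.{u}.toLinearMap, continuous_diagonal⟩ :
      (Fin 3 → ℂ) →L[ℂ] (QuadPoly.{u} →L[ℂ] QuadPoly.{u})).restrictScalars ℝ
  have h1 := map_vectorMeasure_integral (μ := μ)
    (B := (ContinuousLinearMap.lsmul ℝ ℂ).flip)
    (B' := (ContinuousLinearMap.lsmul ℝ ℂ).flip) D D
    (fun y c => diagonal.{u}.toLinearMap.map_smul c y) hf
  have h2 (k : Fin 3) := map_vectorMeasure_integral (μ := μ)
    (B := (ContinuousLinearMap.lsmul ℝ ℂ).flip)
    (B' := ContinuousLinearMap.mul ℝ ℂ)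
    (ContinuousLinearMap.proj (R := ℝ) (φ := fun _ : Fin 3 => ℂ) k)
    (ContinuousLinearMap.proj (R := ℝ) (φ := fun _ : Fin 3 => ℂ) k)
    (fun y c => mul_comm _ _) hf
  have h3 : VectorMeasure.integral μ f (ContinuousLinearMap.lsmul ℝ ℂ).flip =
      fun k => fourierStieltjes μ (x k) := by
    ext k
    refine (h2 k).trans ?_
    simp only [fourierStieltjes, f, ContinuousLinearMap.proj_apply]
    congr 1
    ext t
    ring_nf
  unfold expIntegral
  simp_rw [exp_smul_diagonal]
  rw [h3] at h1
  exact h1.symm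

/-- An algebra homomorphism shrinks spectra, and the spectrum of `d` in `ℂ³` is its set of
coordinates. -/
theorem spectralRadius_diagonal_le (d : Fin 3 → ℂ) {M : ℝ} (hM : ∀ k, ‖d k‖ ≤ M) :
    spectralRadius ℂ (diagonal.{u} d) ≤ ENNReal.ofReal M := by
  refine iSup₂_le fun z hz => ?_
  have hz' := AlgHom.spectrum_apply_subset diagonal.{u} d hz
  rw [Pi.spectrum_eq, Set.mem_iUnion] at hz'
  obtain ⟨k, hk⟩ := hz'
  have : z = d k := by
    have h := spectrum.scalar_eq (𝕜 := ℂ) (A := ℂ) (d k)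
    rw [Algebra.algebraMap_self_apply] at h
    rw [h] at hk
    exact hk
  rw [this, ← enorm_eq_nnnorm, ← ofReal_norm]
  exact ENNReal.ofReal_le_ofReal (hM k)

end QuadPoly

open QuadPoly in
theorem IsUniversalSymbol.norm_diagonal_le {F : ℝ → ℂ} (hF : IsUniversalSymbol.{u} F) (x h : ℝ)
    {M : ℝ} (hM : ∀ k : Fin 3, ‖F (x + (k : ℕ) * h)‖ ≤ M) :
    ‖diagonal.{u} fun k => F (x + (k : ℕ) * h)‖ ≤ M := by
  let a := diagonal.{u} fun k => ((x + (k : ℕ) * h : ℝ) : ℂ)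
  -- Adjoining the progression to the spectrum makes `F = μ̂` at its points without computing the
  -- spectrum.
  have hK : IsCompact (Complex.ofReal ⁻¹' spectrum ℂ a ∪
      Set.range fun k : Fin 3 => x + (k : ℕ) * h) :=
    (Complex.isometry_ofReal.isClosedEmbedding.isCompact_preimage (spectrum.isCompact a)).union
      (Set.finite_range _).isCompact
  obtain ⟨μ, hμ⟩ := hF.1 _ hK
  have hval : expIntegral μ a = diagonal.{u} fun k => F (x + (k : ℕ) * h) := by
    rw [expIntegral_diagonal μ fun k => x + (k : ℕ) * h]
    congr 1
    ext k
    exact (hμ.self_of_nhdsSet _ (Or.inr ⟨k, rfl⟩)).symm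
  have hb := hF.2 (QuadPoly.{u} →L[ℂ] QuadPoly.{u}) a _ (isHermitian_diagonal x h)
    ⟨μ, hμ.filter_mono (nhdsSet_mono Set.subset_union_left), hval.symm⟩
  have hle := hb.trans_le (spectralRadius_diagonal_le _ hM)
  rw [← ofReal_norm] at hle
  exact (ENNReal.ofReal_le_ofReal_iff ((norm_nonneg _).trans (hM 0))).1 hle

/-! ### Positivity of extremal functionals and its consequences -/

/-- A linear functional on polynomials of degree at most two that attains its supremum norm `1` at
the monomial `z ^ j` is positive after the shift by `j`. -/
theorem re_coeff_sum_nonneg {d p : Fin 3 → ℂ} (j : Fin 3) (hdj : d j = 1)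
    (hd : ∀ (q : Fin 3 → ℂ) (C : ℝ), 0 ≤ C →
      (∀ z : Circle, ‖q 0 + q 1 * z + q 2 * (z : ℂ) ^ 2‖ ≤ C) →
      ‖d 0 * q 0 + d 1 * q 1 + d 2 * q 2‖ ≤ C)
    (hp : ∀ z : Circle,
      0 ≤ (star (z : ℂ) ^ (j : ℕ) * (p 0 + p 1 * z + p 2 * (z : ℂ) ^ 2)).re) :
    0 ≤ (d 0 * p 0 + d 1 * p 1 + d 2 * p 2).re := by
  set K : ℝ := ‖p 0‖ + ‖p 1‖ + ‖p 2‖ with hK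
  have hpK (z : Circle) : ‖p 0 + p 1 * z + p 2 * (z : ℂ) ^ 2‖ ≤ K := by
    refine (norm_add₃_le).trans ?_
    simp [hK, Circle.norm_coe]
  have main (ε : ℝ) (hε : 0 < ε) :
      1 - ε * (d 0 * p 0 + d 1 * p 1 + d 2 * p 2).re ≤ √(1 + ε ^ 2 * K ^ 2) := by
    -- Perturbing the extremal monomial by `-εp` raises the supremum norm only to second order in
    -- `ε`, because `p` has nonnegative real part after the shift.
    set q : Fin 3 → ℂ := Pi.single j 1 - (ε : ℂ) • p with hq
    have h := hd q (√(1 + ε ^ 2 * K ^ 2)) (Real.sqrt_nonneg _) ?_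
    · have e : d 0 * q 0 + d 1 * q 1 +
          d 2 * q 2 =
          1 - ε * (d 0 * p 0 + d 1 * p 1 + d 2 * p 2) := by
        rw [← hdj]
        fin_cases j <;> simp [hq] <;> ring
      rw [e] at h
      refine le_trans (le_of_eq ?_) ((Complex.re_le_norm _).trans h)
      rw [Complex.sub_re, Complex.re_ofReal_mul, Complex.one_re]
    · intro z
      set P := p 0 + p 1 * z + p 2 * (z : ℂ) ^ 2 with hP
      have hzz : star (z : ℂ) * z = 1 := by
        have := Complex.conj_mul' (z : ℂ)
        simpa [Circle.norm_coe] using this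
      have e : q 0 + q 1 * z + q 2 * (z : ℂ) ^ 2 = (z : ℂ) ^ (j : ℕ) - ε * P := by
        fin_cases j <;> simp [hP, hq] <;> ring
      have e2 : (z : ℂ) ^ (j : ℕ) - ε * P =
          (z : ℂ) ^ (j : ℕ) * (1 - ε * (star (z : ℂ) ^ (j : ℕ) * P)) := by
        have : star (z : ℂ) ^ (j : ℕ) * (z : ℂ) ^ (j : ℕ) = 1 := by rw [← mul_pow, hzz, one_pow]
        linear_combination ε * P * this
      rw [e, e2, norm_mul, norm_pow, Circle.norm_coe, one_pow, one_mul]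
      refine Real.le_sqrt_of_sq_le ?_
      have hQ := hp z
      rw [← hP] at hQ
      have hQn : ‖star (z : ℂ) ^ (j : ℕ) * P‖ ≤ K := by
        simpa [Circle.norm_coe] using hpK z
      set Q := star (z : ℂ) ^ (j : ℕ) * P
      have hQ2 : ‖Q‖ ^ 2 ≤ K ^ 2 := pow_le_pow_left₀ (norm_nonneg _) hQn 2
      rw [Complex.sq_norm, Complex.normSq_apply] at hQ2 ⊢
      simp only [Complex.sub_re, Complex.sub_im, Complex.one_re, Complex.one_im,
        Complex.re_ofReal_mul, Complex.im_ofReal_mul]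
      nlinarith [mul_nonneg hε.le hQ, mul_le_mul_of_nonneg_left hQ2 (sq_nonneg ε)]
  set R := (d 0 * p 0 + d 1 * p 1 + d 2 * p 2).re
  by_contra! hneg
  -- With this `ε`, `(1 - εR)² = (1 + ε²(1 + K²))²`, which exceeds `1 + ε²K²`.
  have h1 := main (-R / (1 + K ^ 2)) (by have := neg_pos.2 hneg; positivity)
  set ε := -R / (1 + K ^ 2) with hε
  have hεp : 0 < ε := by have := neg_pos.2 hneg; positivity
  have hR : R = -(ε * (1 + K ^ 2)) := by rw [hε]; field_simp
  have h2 : (1 - ε * R) ^ 2 ≤ 1 + ε ^ 2 * K ^ 2 := by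
    rw [← Real.sq_sqrt (by positivity : 0 ≤ 1 + ε ^ 2 * K ^ 2)]
    refine pow_le_pow_left₀ ?_ h1 2
    rw [hR]
    nlinarith [mul_pos hεp hεp, mul_nonneg (mul_pos hεp hεp).le (sq_nonneg K)]
  rw [hR] at h2
  nlinarith [mul_pos hεp hεp, mul_nonneg (mul_pos hεp hεp).le (sq_nonneg K),
    sq_nonneg (ε * (ε * (1 + K ^ 2)))]

/-- A function on `ℝ` whose restriction to each three-term arithmetic progression, viewed as a
coefficient functional on polynomials of degree at most two, has norm `max |F|`. -/
def IsTernaryExtremal (F : ℝ → ℂ) : Prop :=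
  ∀ (x h M : ℝ), (∀ k : Fin 3, ‖F (x + (k : ℕ) * h)‖ ≤ M) → ∀ (p : Fin 3 → ℂ) (C : ℝ), 0 ≤ C →
    (∀ z : Circle, ‖p 0 + p 1 * z + p 2 * (z : ℂ) ^ 2‖ ≤ C) →
      ‖F x * p 0 + F (x + h) * p 1 + F (x + 2 * h) * p 2‖ ≤ M * C

theorem IsUniversalSymbol.isTernaryExtremal {F : ℝ → ℂ} (hF : IsUniversalSymbol.{u} F) :
    IsTernaryExtremal F := by
  intro x h M hM p C hC hp
  have h1 := QuadPoly.norm_coeff_sum_le.{u} (fun k => F (x + (k : ℕ) * h)) p hC hp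
  have h2 := h1.trans (mul_le_mul_of_nonneg_right (hF.norm_diagonal_le x h hM) hC)
  simpa using h2

namespace IsTernaryExtremal

variable {F : ℝ → ℂ}

theorem re_nonneg (hF : IsTernaryExtremal F) (x h : ℝ) (j : Fin 3)
    (hj : ∀ k : Fin 3, ‖F (x + (k : ℕ) * h)‖ ≤ ‖F (x + (j : ℕ) * h)‖)
    (hj0 : F (x + (j : ℕ) * h) ≠ 0) (p : Fin 3 → ℂ)
    (hp : ∀ z : Circle,
      0 ≤ (star (z : ℂ) ^ (j : ℕ) * (p 0 + p 1 * z + p 2 * (z : ℂ) ^ 2)).re) :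
    0 ≤ ((F x * p 0 + F (x + h) * p 1 + F (x + 2 * h) * p 2) / F (x + (j : ℕ) * h)).re := by
  have h1 := re_coeff_sum_nonneg (d := fun k => F (x + (k : ℕ) * h) / F (x + (j : ℕ) * h)) (p := p)
    j (div_self hj0) ?_ hp
  · convert h1 using 2
    simp
    ring
  · intro q C hC hq
    have := hF x h _ hj q C hC hq
    rw [← div_le_iff₀' (norm_pos_iff.2 hj0), ← norm_div] at this
    refine le_of_eq_of_le (congrArg norm ?_) this
    simp
    ring

/-- For `|v| = 1`, `Re (3 - 4v + v²) = 2 (1 - Re v)²` is nonnegative. -/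
theorem re_nonneg_of_norm_le_left (hF : IsTernaryExtremal F) {x h : ℝ}
    (h1 : ‖F (x + h)‖ ≤ ‖F x‖) (h2 : ‖F (x + 2 * h)‖ ≤ ‖F x‖) (h0 : F x ≠ 0) {w : ℂ}
    (hw : ‖w‖ = 1) :
    0 ≤ 3 - 4 * (w * (F (x + h) / F x)).re + (w ^ 2 * (F (x + 2 * h) / F x)).re := by
  have hre := hF.re_nonneg x h 0 (by intro k; fin_cases k <;> simp [h1, h2]) (by simpa using h0)
    ![3, -4 * w, w ^ 2] ?_
  · have e : (F x * 3 + F (x + h) * (-4 * w) + F (x + 2 * h) * w ^ 2) / F x =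
        3 - (4 : ℝ) * (w * (F (x + h) / F x)) + w ^ 2 * (F (x + 2 * h) / F x) := by
      field_simp
      push_cast
      ring
    simp only [Matrix.cons_val, Fin.val_zero, Nat.cast_zero, zero_mul, add_zero] at hre
    rw [e, Complex.add_re, Complex.sub_re, Complex.re_ofReal_mul] at hre
    simpa using hre
  · intro z
    have hv : ‖w * z‖ = 1 := by simp [hw, Circle.norm_coe]
    have e : star (z : ℂ) ^ ((0 : Fin 3) : ℕ) * (![3, -4 * w, w ^ 2] 0 + ![3, -4 * w, w ^ 2] 1 * z +
        ![3, -4 * w, w ^ 2] 2 * (z : ℂ) ^ 2) = 3 - (4 : ℝ) * (w * z) + (w * z) ^ 2 := by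
      simp
      ring
    rw [e]
    set v := w * (z : ℂ)
    have hv2 : v.re * v.re + v.im * v.im = 1 := by
      rw [← Complex.normSq_apply, ← Complex.sq_norm, hv, one_pow]
    rw [Complex.add_re, Complex.sub_re, Complex.re_ofReal_mul, pow_two, Complex.mul_re v v,
      Complex.re_ofNat]
    nlinarith [sq_nonneg (v.re - 1)]

theorem norm_le_of_norm_le_left (hF : IsTernaryExtremal F) {x h : ℝ}
    (h1 : ‖F (x + h)‖ ≤ ‖F x‖) (h2 : ‖F (x + 2 * h)‖ ≤ ‖F x‖) :
    4 * ‖F (x + h)‖ ≤ 3 * ‖F x‖ + ‖F (x + 2 * h)‖ := by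
  by_cases h0 : F x = 0
  · rw [h0, norm_zero] at h1 h2
    linarith [norm_nonneg (F (x + h)), norm_nonneg (F x), norm_nonneg (F (x + 2 * h))]
  obtain ⟨w, hw, hwz⟩ : ∃ w : ℂ, ‖w‖ = 1 ∧ w * (F (x + h) / F x) = ‖F (x + h) / F x‖ := by
    by_cases hz : F (x + h) / F x = 0
    · exact ⟨1, by simp, by simp [hz]⟩
    · have hz' : (‖F (x + h) / F x‖ : ℂ) ≠ 0 := by
        rwa [Ne, Complex.ofReal_eq_zero, norm_eq_zero]
      exact ⟨‖F (x + h) / F x‖ / (F (x + h) / F x),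
        by rw [norm_div (‖F (x + h) / F x‖ : ℂ), Complex.norm_real, norm_norm,
          div_self (norm_ne_zero_iff.2 hz)], div_mul_cancel₀ _ hz⟩
  have hre := hF.re_nonneg_of_norm_le_left h1 h2 h0 hw
  rw [hwz, Complex.ofReal_re] at hre
  have h3 := Complex.re_le_norm (w ^ 2 * (F (x + 2 * h) / F x))
  rw [norm_mul, norm_pow, hw, one_pow, one_mul] at h3
  have h4 : 0 ≤ 3 - 4 * (‖F (x + h)‖ / ‖F x‖) + ‖F (x + 2 * h)‖ / ‖F x‖ := by
    rw [← norm_div, ← norm_div]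
    linarith
  have hp : 0 < ‖F x‖ := norm_pos_iff.2 h0
  have e : 3 - 4 * (‖F (x + h)‖ / ‖F x‖) + ‖F (x + 2 * h)‖ / ‖F x‖ =
      (3 * ‖F x‖ - 4 * ‖F (x + h)‖ + ‖F (x + 2 * h)‖) / ‖F x‖ := by
    field_simp
  rw [e, le_div_iff₀ hp] at h4
  linarith

theorem mul_eq_sq_of_norm_eq (hF : IsTernaryExtremal F) {x h : ℝ}
    (h1 : ‖F (x + h)‖ = ‖F x‖) (h2 : ‖F (x + 2 * h)‖ = ‖F x‖) :
    F x * F (x + 2 * h) = F (x + h) ^ 2 := by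
  by_cases h0 : F x = 0
  · rw [h0, norm_zero, norm_eq_zero] at h1
    rw [h0, h1]
    simp
  have h0' : F (x + h) ≠ 0 := by rwa [← norm_ne_zero_iff, h1, norm_ne_zero_iff]
  have hp : ‖F x‖ ≠ 0 := norm_ne_zero_iff.2 h0
  have hw : ‖F x / F (x + h)‖ = 1 := by rw [norm_div, h1, div_self hp]
  -- With this phase the inequality reads `0 ≤ 3 - 4 + Re q` with `|q| = 1`, forcing `q = 1`.
  have hre := hF.re_nonneg_of_norm_le_left h1.le h2.le h0 hw
  have e : F x / F (x + h) * (F (x + h) / F x) = 1 := by field_simp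
  rw [e, Complex.one_re] at hre
  set q := (F x / F (x + h)) ^ 2 * (F (x + 2 * h) / F x) with hq
  have hqn : ‖q‖ = 1 := by rw [hq, norm_mul, norm_pow, hw, norm_div, h2, div_self hp]; simp
  have hq1 : q = 1 := by
    have hr : q.re = ‖q‖ := le_antisymm (Complex.re_le_norm q) (by rw [hqn]; linarith)
    have := Complex.re_eq_norm.1 hr
    rw [Complex.eq_coe_norm_of_nonneg this, hqn, Complex.ofReal_one]
  rw [hq] at hq1
  field_simp at hq1
  rwa [mul_comm h 2] at hq1

theorem norm_eq_of_norm_le_middle (hF : IsTernaryExtremal F) {x h : ℝ}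
    (h0 : ‖F x‖ ≤ ‖F (x + h)‖) (h2 : ‖F (x + 2 * h)‖ ≤ ‖F (x + h)‖) :
    ‖F x‖ = ‖F (x + 2 * h)‖ := by
  by_cases h1 : F (x + h) = 0
  · rw [h1, norm_zero] at h0 h2
    linarith [norm_nonneg (F x), norm_nonneg (F (x + 2 * h))]
  -- After the shift by `1` the test polynomial is purely imaginary on the circle. Taking `c = ±1,
  -- ±i` turns the inequalities into `A = star C`.
  have key (c : ℂ) : 0 ≤ ((F x * c - F (x + 2 * h) * star c) / F (x + h)).re := by
    have hre := hF.re_nonneg x h 1 (by intro k; fin_cases k <;> simp [h0, h2]) (by simpa using h1)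
      ![c, 0, -star c] ?_
    · simpa [sub_eq_add_neg] using hre
    · intro z
      have e : star (z : ℂ) ^ ((1 : Fin 3) : ℕ) * (![c, 0, -star c] 0 + ![c, 0, -star c] 1 * z +
          ![c, 0, -star c] 2 * (z : ℂ) ^ 2) = star (z : ℂ) * c - star (star (z : ℂ) * c) := by
        have hzz : star (z : ℂ) * z = 1 := by
          have := Complex.conj_mul' (z : ℂ)
          simpa [Circle.norm_coe] using this
        simp only [Matrix.cons_val, Fin.val_one, pow_one, star_mul, star_star]
        linear_combination -(star c * z) * hzz
      rw [e]
      simp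
  set A := F x / F (x + h) with hA
  set C := F (x + 2 * h) / F (x + h) with hC
  have key' (c : ℂ) : 0 ≤ (A * c - C * star c).re := by
    have := key c
    rwa [sub_div, mul_div_right_comm, mul_div_right_comm] at this
  have k1 := key' 1
  have k2 := key' (-1)
  have k3 := key' Complex.I
  have k4 := key' (-Complex.I)
  simp at k1 k2 k3 k4
  have hAC : A = star C := by
    apply Complex.ext
    · simp; linarith
    · simp; linarith
  have hn : ‖A‖ = ‖C‖ := by rw [hAC, norm_star]
  rw [hA, hC, norm_div, norm_div, div_left_inj' (norm_ne_zero_iff.2 h1)] at hn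
  exact hn

end IsTernaryExtremal

/-! ### Bounded three-point convex functions are constant -/

/-- Constraints on the values at three points in arithmetic progression that force a bounded
continuous function to be constant. -/
structure IsThreePointConvex (g : ℝ → ℝ) : Prop where
  end_le : ∀ x h, g (x + h) ≤ g x → g (x + 2 * h) ≤ g x → 4 * g (x + h) ≤ 3 * g x + g (x + 2 * h)
  eq_of_middle_max : ∀ x h, g x ≤ g (x + h) → g (x + 2 * h) ≤ g (x + h) → g x = g (x + 2 * h)

namespace IsThreePointConvex

variable {g : ℝ → ℝ}

theorem comp_neg (hg : IsThreePointConvex g) : IsThreePointConvex fun x => g (-x) where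
  end_le x h h1 h2 := by
    have e1 : -(x + h) = -x + -h := by ring
    have e2 : -(x + 2 * h) = -x + 2 * -h := by ring
    simp only [e1, e2] at *
    exact hg.end_le _ _ h1 h2
  eq_of_middle_max x h h1 h2 := by
    have e1 : -(x + h) = -x + -h := by ring
    have e2 : -(x + 2 * h) = -x + 2 * -h := by ring
    simp only [e1, e2] at *
    exact hg.eq_of_middle_max _ _ h1 h2

/-- A maximum in the interior of an interval forces constancy around it. -/
theorem eq_of_interior_max (hg : IsThreePointConvex g) (hc : Continuous g) {x r : ℝ}
    (hmax : ∀ y, |y| ≤ r → g (x + y) ≤ g x) {y : ℝ} (hy : |y| ≤ r) : g (x + y) = g x := by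
  have hsymm (z : ℝ) (hz : |z| ≤ r) : g (x - z) = g (x + z) := by
    have h := hg.eq_of_middle_max (x - z) z
    have e : x - z + 2 * z = x + z := by ring
    rw [sub_add_cancel, e] at h
    exact h (hmax (-z) (by rwa [abs_neg])) (hmax z hz)
  -- Uses the progression `x - z/3`, `x + z/3`, `x + z`, whose first two values agree by symmetry.
  -- Iterating moves the point to `x`.
  have hthird (z : ℝ) (hz : |z| ≤ r) : g (x + z / 3) ≤ g (x + z) := by
    by_contra! hlt
    have hz3 : |z / 3| ≤ r := by
      rw [abs_div, abs_of_pos (by norm_num : (0 : ℝ) < 3)]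
      linarith [abs_nonneg z]
    have h := hg.end_le (x - z / 3) (2 * z / 3)
    have e1 : x - z / 3 + 2 * z / 3 = x + z / 3 := by ring
    have e2 : x - z / 3 + 2 * (2 * z / 3) = x + z := by ring
    rw [e1, e2, hsymm _ hz3] at h
    linarith [h le_rfl hlt.le]
  have hpow (n : ℕ) : |y / 3 ^ n| ≤ r ∧ g (x + y / 3 ^ n) ≤ g (x + y) := by
    induction n with
    | zero => simpa using hy
    | succ n ih =>
      have e : y / 3 ^ (n + 1) = y / 3 ^ n / 3 := by rw [pow_succ, div_div]
      rw [e]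
      refine ⟨?_, (hthird _ ih.1).trans ih.2⟩
      rw [abs_div, abs_of_pos (by norm_num : (0 : ℝ) < 3)]
      linarith [abs_nonneg (y / 3 ^ n), ih.1]
  have hlim : Filter.Tendsto (fun n : ℕ => g (x + y / 3 ^ n)) Filter.atTop (𝓝 (g (x + 0))) := by
    refine (hc.tendsto _).comp (tendsto_const_nhds.add ?_)
    exact tendsto_const_nhds.div_atTop (tendsto_pow_atTop_atTop_of_one_lt (by norm_num))
  rw [add_zero] at hlim
  exact le_antisymm (hmax y hy) (le_of_tendsto' hlim fun n => (hpow n).2)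

theorem endpoint_max (hg : IsThreePointConvex g) (hc : Continuous g) {p q : ℝ} (hpq : p ≤ q) :
    (∀ x ∈ Set.Icc p q, g x ≤ g p) ∨ ∀ x ∈ Set.Icc p q, g x ≤ g q := by
  obtain ⟨m, hm, hmmax⟩ := isCompact_Icc.exists_isMaxOn (Set.nonempty_Icc.2 hpq) hc.continuousOn
  -- `s` is the rightmost maximum point; were it interior, local constancy would give one further
  -- right.
  obtain ⟨s, ⟨⟨hs, hsm⟩, hsmax⟩⟩ :=
    (isCompact_Icc.inter_right (isClosed_singleton.preimage hc)).exists_isGreatest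
      (s := Set.Icc p q ∩ g ⁻¹' {g m}) ⟨m, hm, rfl⟩
  replace hsm : g s = g m := hsm
  have hle : ∀ x ∈ Set.Icc p q, g x ≤ g s := fun x hx => (hmmax hx).trans_eq hsm.symm
  rcases hs.1.eq_or_lt with h | h
  · exact Or.inl (h ▸ hle)
  rcases hs.2.eq_or_lt with h' | h'
  · exact Or.inr (h' ▸ hle)
  exfalso
  set r := min (s - p) (q - s)
  have hr : 0 < r := lt_min (sub_pos.2 h) (sub_pos.2 h')
  have hrp : r ≤ s - p := min_le_left _ _
  have hrq : r ≤ q - s := min_le_right _ _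
  have hmem (y : ℝ) (hy : |y| ≤ r) : s + y ∈ Set.Icc p q := by
    have := abs_le.1 hy
    constructor <;> linarith
  have habs : |r| ≤ r := (abs_of_pos hr).le
  have heq := hg.eq_of_interior_max hc (fun y hy => hle _ (hmem y hy)) habs
  have := hsmax ⟨hmem r habs, heq.trans hsm⟩
  linarith

theorem antitone_of_bddAbove (hg : IsThreePointConvex g) (hc : Continuous g)
    (hb : BddAbove (Set.range g)) : Antitone g := by
  intro p q hpq
  by_contra! hlt
  have hright (t : ℝ) (ht : q ≤ t) : ∀ x ∈ Set.Icc p t, g x ≤ g t := by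
    rcases hg.endpoint_max hc (hpq.trans ht) with h | h
    · exact absurd (h q ⟨hpq, ht⟩) hlt.not_ge
    · exact h
  have hbq : BddAbove (g '' Set.Ici q) := hb.mono (Set.image_subset_range _ _)
  -- Let `S` be the supremum over `[q, ∞)`. The progression `2v - p`, `v`, `p` gives `4 g v ≤ 3S + g
  -- p`, while `4 g v > 4S - (g q - g p)`; hence `S < g q`, a contradiction.
  obtain ⟨_, ⟨v, hv, rfl⟩, hvM⟩ := exists_lt_of_lt_csSup (s := g '' Set.Ici q)
    ⟨_, q, Set.self_mem_Ici, rfl⟩ (sub_lt_self _ (by linarith : 0 < (g q - g p) / 4))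
  have hqM : g q ≤ sSup (g '' Set.Ici q) := le_csSup hbq ⟨q, Set.self_mem_Ici, rfl⟩
  have hpv : p ≤ v := hpq.trans hv
  have hvt : v ≤ 2 * v - p := by linarith
  have htM : g (2 * v - p) ≤ sSup (g '' Set.Ici q) := le_csSup hbq ⟨_, le_trans hv hvt, rfl⟩
  have h := hg.end_le (2 * v - p) (p - v)
  have e1 : 2 * v - p + (p - v) = v := by ring
  have e2 : 2 * v - p + 2 * (p - v) = p := by ring
  rw [e1, e2] at h
  have hmax := hright (2 * v - p) (le_trans hv hvt)
  linarith [h (hmax v ⟨hpv, hvt⟩) (hmax p ⟨le_rfl, hpv.trans hvt⟩)]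

theorem eq_of_bddAbove (hg : IsThreePointConvex g) (hc : Continuous g)
    (hb : BddAbove (Set.range g)) (x y : ℝ) : g x = g y := by
  have h1 := hg.antitone_of_bddAbove hc hb
  have h2 : Antitone fun x => g (-x) := hg.comp_neg.antitone_of_bddAbove (hc.comp continuous_neg)
    (hb.mono (Set.range_comp_subset_range Neg.neg g))
  have h3 : Monotone g := fun a b hab => by simpa using h2 (neg_le_neg hab)
  rcases le_total x y with h | h
  · exact le_antisymm (h3 h) (h1 h)
  · exact le_antisymm (h1 h) (h3 h)

end IsThreePointConvex

theorem IsTernaryExtremal.isThreePointConvex_norm {F : ℝ → ℂ} (hF : IsTernaryExtremal F) :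
    IsThreePointConvex fun x => ‖F x‖ :=
  ⟨fun _ _ => hF.norm_le_of_norm_le_left, fun _ _ => hF.norm_eq_of_norm_le_middle⟩

/-! ### Continuous characters and the conclusion -/

theorem exists_hasDerivAt_of_map_add_eq_mul {χ : ℝ → ℂ} (hc : Continuous χ) (h0 : χ 0 = 1)
    (hadd : ∀ x y, χ (x + y) = χ x * χ y) : ∃ β : ℂ, ∀ x, HasDerivAt χ (β * χ x) x := by
  let Φ : ℝ → ℂ := fun x => ∫ t in (0 : ℝ)..x, χ t
  have hΦ (x : ℝ) : HasDerivAt Φ (χ x) x := (hc.integral_hasStrictDerivAt 0 x).hasDerivAt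
  obtain ⟨h, hh⟩ : ∃ h, Φ h ≠ 0 := by
    by_contra! hall
    have hz : Φ = fun _ => 0 := funext hall
    have h1 := hΦ 0
    rw [hz, h0] at h1
    exact zero_ne_one ((hasDerivAt_const (0 : ℝ) (0 : ℂ)).unique h1)
  -- Integrating the functional equation over `[0, h]` makes `χ` inherit differentiability from its
  -- primitive.
  have hχ : χ = fun x => (Φ (x + h) - Φ x) / Φ h := by
    ext x
    rw [eq_div_iff hh]
    have e : χ x * Φ h = ∫ t in (0 : ℝ)..h, χ (x + t) := by
      simp only [hadd, intervalIntegral.integral_const_mul, Φ]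
    rw [e, intervalIntegral.integral_comp_add_left, add_zero]
    exact (intervalIntegral.integral_interval_sub_left (hc.intervalIntegrable _ _)
      (hc.intervalIntegrable _ _)).symm
  have hd : ∃ β, HasDerivAt χ β 0 := by
    rw [hχ]
    exact ⟨_, (((hΦ (0 + h)).comp_add_const 0 h).sub (hΦ 0)).div_const _⟩
  obtain ⟨β, hβ⟩ := hd
  refine ⟨β, fun x => ?_⟩
  have h1 : HasDerivAt (fun y => χ x * χ (y + -x)) (χ x * β) x :=
    (HasDerivAt.comp_add_const x (-x) (by rwa [add_neg_cancel])).const_mul _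
  rw [mul_comm]
  convert h1 using 1
  ext y
  rw [← hadd]
  ring_nf

/-- Continuous unitary characters of `ℝ` are exponentials. -/
theorem exists_eq_exp_of_map_add_eq_mul {χ : ℝ → ℂ} (hc : Continuous χ) (h1 : ∀ x, ‖χ x‖ = 1)
    (hadd : ∀ x y, χ (x + y) = χ x * χ y) :
    ∃ α : ℝ, ∀ x : ℝ, χ x = Complex.exp (Complex.I * α * x) := by
  have h0 : χ 0 = 1 := by
    have h := hadd 0 0
    rw [add_zero] at h
    exact (mul_eq_left₀ (norm_ne_zero_iff.1 (by rw [h1 0]; exact one_ne_zero))).1 h.symm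
  obtain ⟨β, hβ⟩ := exists_hasDerivAt_of_map_add_eq_mul hc h0 hadd
  have hexp (x : ℝ) : χ x = Complex.exp (β * x) := by
    have hd (x : ℝ) : HasDerivAt (fun x : ℝ => χ x * Complex.exp (-β * x)) 0 x := by
      have h2 : HasDerivAt (fun x : ℝ => Complex.exp (-β * x)) (Complex.exp (-β * x) * (-β * 1)) x :=
        ((Complex.ofRealCLM.hasDerivAt (x := x)).const_mul (-β)).cexp
      have h3 : β * χ x * Complex.exp (-β * x) + χ x * (Complex.exp (-β * x) * (-β * 1)) = 0 := by
        ring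
      exact h3 ▸ (hβ x).mul h2
    have h := is_const_of_deriv_eq_zero (fun x => (hd x).differentiableAt) (fun x => (hd x).deriv)
      x 0
    simp only [h0, Complex.ofReal_zero, mul_zero, Complex.exp_zero, mul_one, neg_mul] at h
    rwa [Complex.exp_neg, mul_inv_eq_one₀ (Complex.exp_ne_zero _)] at h
  have hre : β.re = 0 := by
    have h := h1 1
    rw [hexp, Complex.norm_exp] at h
    simpa using h
  refine ⟨β.im, fun x => ?_⟩
  rw [hexp]
  congr 2
  apply Complex.ext <;> simp [hre]

theorem IsTernaryExtremal.exists_eq_exp {F : ℝ → ℂ} (hF : IsTernaryExtremal F) (hc : Continuous F)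
    (hb : BddAbove (Set.range fun x => ‖F x‖)) :
    ∃ (α : ℝ) (c : ℂ), ∀ x : ℝ, F x = c * Complex.exp (Complex.I * α * x) := by
  have hnorm (x : ℝ) : ‖F x‖ = ‖F 0‖ :=
    hF.isThreePointConvex_norm.eq_of_bddAbove hc.norm hb x 0
  by_cases h0 : F 0 = 0
  · refine ⟨0, 0, fun x => ?_⟩
    rw [zero_mul, ← norm_eq_zero, hnorm, h0, norm_zero]
  have hmid (x h : ℝ) : F x * F (x + 2 * h) = F (x + h) ^ 2 :=
    hF.mul_eq_sq_of_norm_eq ((hnorm _).trans (hnorm _).symm) ((hnorm _).trans (hnorm _).symm)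
  -- The progressions from `0` to `x + y` and from `x` to `y` share their midpoint.
  have hadd (x y : ℝ) : F (x + y) / F 0 = F x / F 0 * (F y / F 0) := by
    have e1 := hmid 0 ((x + y) / 2)
    have e2 := hmid x ((y - x) / 2)
    have e3 : 0 + 2 * ((x + y) / 2) = x + y := by ring
    have e4 : 0 + (x + y) / 2 = x + (y - x) / 2 := by ring
    have e5 : x + 2 * ((y - x) / 2) = y := by ring
    rw [e3, e4] at e1
    rw [e5] at e2
    field_simp
    rw [mul_comm, e1, e2]
  obtain ⟨α, hα⟩ := exists_eq_exp_of_map_add_eq_mul (χ := fun x => F x / F 0) (hc.div_const _)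
    (fun x => by rw [norm_div, hnorm, div_self (norm_ne_zero_iff.2 h0)]) hadd
  exact ⟨α, F 0, fun x => by rw [← hα, mul_div_cancel₀ _ h0]⟩

end UniversalSymbols

end

theorem corollary2p3 (F : ℝ → ℂ) (hF : UniversalSymbols.IsUniversalSymbol.{u} F) :
    (∃ C : ℝ, ∀ x : ℝ, ‖F x‖ ≤ C) ↔
      ∃ (α : ℝ) (c : ℂ), ∀ x : ℝ, F x = c * Complex.exp (Complex.I * α * x) := by
  constructor
  · rintro ⟨C, hC⟩
    refine hF.isTernaryExtremal.exists_eq_exp hF.1.continuous ⟨C, ?_⟩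
    rintro _ ⟨x, rfl⟩
    exact hC x
  · rintro ⟨α, c, h⟩
    refine ⟨‖c‖, fun x => ?_⟩
    rw [h, norm_mul, UniversalSymbols.norm_exp_I_mul, mul_one]
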